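/- Let $R$ be an associative ring with $1$; modules are right $R$-modules and $\mathrm{fpmod}(R)$ is the category of finitely presented ones. Call a full subcategory $\mathcal E$ of $\mathrm{fpmod}(R)$ \emph{pre-localising} if every object of $\mathcal E$ has homological (projective) dimension at most $1$ and $\mathcal E$ is closed under extensions, under kernels of surjective maps, and under cokernels of injective maps whose cokernel has homological dimension $1$; and if, for every map $\varphi\colon A\to B$ in $\mathcal E$ whose cokernel has homological dimension $1$, $\operatorname{coker}\varphi$ lies in $\mathcal E$, and $\operatorname{im}\varphi$ and $\ker\varphi$ lie in $\mathcal E$ whenever they are finitely presented. (Requiring these conditions only for cokernels of dimension exactly $1$, as here, is the weakest form; the statement therefore also covers the version with dimension at most $1$.) In the torsion theory generated by $\mathcal E$, a module $F$ is torsion-free if $\operatorname{Hom}(N,F)=0$ for all $N\in\mathcal E$, and a module $T$ is torsion if $\operatorname{Hom}(T,F)=0$ for every torsion-free $F$; the torsion submodule of $M$ is its largest torsion submodule. Let $R_{\mathcal E}=R_\Sigma$ be the universal localisation of $R$ at $\Sigma$, where $\Sigma$ is any family of injective maps between finitely generated projective modules whose cokernels are, up to isomorphism, exactly the modules in $\mathcal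 E$; that is, $R\to R_\Sigma$ is universal among the ring homomorphisms $R\to S$ for which $\alpha\otimes_R S$ is an isomorphism for every $\alpha\in\Sigma$. \textbf{Theorem.} Let $\mathcal E$ be a pre-localising subcategory of $\mathrm{fpmod}(R)$ such that the kernel of every map in $\mathcal E$ is torsion with respect to the torsion theory generated by $\mathcal E$. Then for every finitely presented module $M$, the kernel of the natural homomorphism $M\to M\otimes_R R_{\mathcal E}$ is the torsion submodule of $M$ with respect to this torsion theory. In particular, if $M$ is finitely presented and torsion-free, then $M\to M\otimes_R R_{\mathcal E}$ is an injective $R$-module homomorphism. -/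

import Mathlib

open MulOpposite TensorProduct CategoryTheory

universe u v w w'

/-! Right `R`-modules are modules over `Rᵐᵒᵖ`; the element `m r` is `op r • m`. -/

namespace UnivLoc

noncomputable section

section Induction

variable {R : Type u} [Ring R] {S : Type v} [Ring S] (f : R →+* S)

/-- The relations `m ⊗ f(r)s = mr ⊗ s` of the tensor product over `R`, as an `S`-submodule of the
tensor product over `ℤ`. The ring factor is written on the left, so `s ⊗ₜ m` stands for `m ⊗ s`;
the right `S`-action is `(s ⊗ₜ m) t = (s t) ⊗ₜ m`. -/
def balanced (M : Type w) [AddCommGroup M] [Module Rᵐᵒᵖ M] : Submodule Sᵐᵒᵖ (S ⊗[ℤ] M) :=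
  Submodule.span Sᵐᵒᵖ {z | ∃ (m : M) (r : R) (s : S), z = (f r * s) ⊗ₜ[ℤ] m - s ⊗ₜ[ℤ] (op r • m)}

/-- The right `S`-module `M ⊗_R S` induced from the right `R`-module `M` along `f : R → S`. -/
abbrev Induced (M : Type w) [AddCommGroup M] [Module Rᵐᵒᵖ M] : Type (max v w) :=
  (S ⊗[ℤ] M) ⧸ balanced f M

namespace Induced

variable {M : Type w} [AddCommGroup M] [Module Rᵐᵒᵖ M]
  {N : Type w'} [AddCommGroup N] [Module Rᵐᵒᵖ N]

/-- The element `m ⊗ s` of `M ⊗_R S`. -/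
def tmul (m : M) (s : S) : Induced f M := Submodule.Quotient.mk (s ⊗ₜ[ℤ] m)

/-- The `S`-linear map out of `M ⊗_R S` given by a biadditive balanced map which is `S`-linear in
the second variable. -/
def lift {X : Type*} [AddCommGroup X] [Module Sᵐᵒᵖ X] (φ : M →+ X)
    (hφ : ∀ m r, φ (op r • m) = op (f r) • φ m) : Induced f M →ₗ[Sᵐᵒᵖ] X :=
  (balanced f M).liftQ
    { toFun := TensorProduct.liftAddHom
        (AddMonoidHom.mk' (fun s => (DistribSMul.toAddMonoidHom X (op s)).comp φ) (by
          intro a b; ext m; simp [add_smul])) (by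
          intro n s m
          change op (n • s) • φ m = op s • φ (n • m)
          rw [map_zsmul, op_smul, smul_assoc, smul_comm])
      map_add' := map_add _
      map_smul' := by
        intro t z
        induction z with
        | zero => simp
        | tmul s m => simp [TensorProduct.smul_tmul', mul_smul, MulOpposite.smul_eq_mul_unop]
        | add a b ha hb => rw [smul_add, map_add, ha, hb, map_add, smul_add] }
    (by
      rw [balanced, Submodule.span_le]
      rintro _ ⟨m, r, s, rfl⟩
      simp [hφ, mul_smul])

@[simp] theorem lift_tmul {X : Type*} [AddCommGroup X] [Module Sᵐᵒᵖ X] (φ : M →+ X)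
    (hφ : ∀ m r, φ (op r • m) = op (f r) • φ m) (m : M) (s : S) :
    lift f φ hφ (tmul f m s) = op s • φ m := rfl

theorem smul_tmul (m : M) (s t : S) : op t • tmul f m s = tmul f m (s * t) := by
  rw [tmul, ← Submodule.Quotient.mk_smul, TensorProduct.smul_tmul']; rfl

theorem tmul_smul (m : M) (r : R) (s : S) : tmul f (op r • m) s = tmul f m (f r * s) :=
  ((Submodule.Quotient.eq (balanced f M)).mpr (Submodule.subset_span ⟨m, r, s, rfl⟩)).symm

theorem add_tmul (m m' : M) (s : S) : tmul f (m + m') s = tmul f m s + tmul f m' s := by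
  simp [tmul, TensorProduct.tmul_add]

theorem tmul_add (m : M) (s s' : S) : tmul f m (s + s') = tmul f m s + tmul f m s' := by
  simp [tmul, TensorProduct.add_tmul]

theorem hom_ext {X : Type*} [AddCommGroup X] [Module Sᵐᵒᵖ X] {φ ψ : Induced f M →ₗ[Sᵐᵒᵖ] X}
    (h : ∀ m, φ (tmul f m 1) = ψ (tmul f m 1)) : φ = ψ := by
  refine LinearMap.ext fun x => ?_
  obtain ⟨z, rfl⟩ := Submodule.Quotient.mk_surjective _ x
  induction z with
  | zero => simp
  | tmul s m =>
    have e : (Submodule.Quotient.mk (s ⊗ₜ[ℤ] m) : Induced f M) = op s • tmul f m 1 := by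
      rw [smul_tmul, one_mul]; rfl
    rw [e, map_smul, map_smul, h]
  | add a b ha hb => rw [Submodule.Quotient.mk_add, map_add, map_add, ha, hb]

variable (M) in
/-- The natural map `M → M ⊗_R S`, `m ↦ m ⊗ 1`; it is semilinear along `f`, that is, it is
`R`-linear for the `R`-module structure on `M ⊗_R S` obtained by restriction along `f`. -/
def unit : M →ₛₗ[f.op] Induced f M where
  toFun m := tmul f m 1
  map_add' a b := by simp [tmul, TensorProduct.tmul_add]
  map_smul' r m := by
    change tmul f (op r.unop • m) 1 = op (f r.unop) • tmul f m 1
    rw [tmul_smul, smul_tmul, one_mul, mul_one]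

/-- The map `α ⊗_R S : M ⊗_R S → N ⊗_R S`, `m ⊗ s ↦ α m ⊗ s`. -/
def map (α : M →ₗ[Rᵐᵒᵖ] N) : Induced f M →ₗ[Sᵐᵒᵖ] Induced f N :=
  lift f (AddMonoidHom.mk' (fun m => tmul f (α m) 1) (by simp [add_tmul])) (by
    intro m r
    simp [tmul_smul, smul_tmul])

@[simp] theorem map_tmul (α : M →ₗ[Rᵐᵒᵖ] N) (m : M) (s : S) :
    map f α (tmul f m s) = tmul f (α m) s := by
  rw [map, lift_tmul, AddMonoidHom.mk'_apply, smul_tmul, one_mul]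

end Induced

end Induction

section Localisation

/-- A map between finitely generated projective right `R`-modules. -/
structure ProjMap (R : Type u) [Ring R] where
  P : Type u
  Q : Type u
  [addCommGroupP : AddCommGroup P]
  [moduleP : Module Rᵐᵒᵖ P]
  [finiteP : Module.Finite Rᵐᵒᵖ P]
  [projectiveP : Module.Projective Rᵐᵒᵖ P]
  [addCommGroupQ : AddCommGroup Q]
  [moduleQ : Module Rᵐᵒᵖ Q]
  [finiteQ : Module.Finite Rᵐᵒᵖ Q]
  [projectiveQ : Module.Projective Rᵐᵒᵖ Q]
  hom : P →ₗ[Rᵐᵒᵖ] Q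

attribute [instance] ProjMap.addCommGroupP ProjMap.moduleP ProjMap.finiteP ProjMap.projectiveP
  ProjMap.addCommGroupQ ProjMap.moduleQ ProjMap.finiteQ ProjMap.projectiveQ

variable {R : Type u} [Ring R]

/-- The ring homomorphism `f : R → S` inverts `α : P → Q` if `α ⊗_R S` is bijective. -/
def Inverts {S : Type v} [Ring S] (f : R →+* S) (α : ProjMap R) : Prop :=
  Function.Bijective (Induced.map f α.hom)

variable {ι : Type w} (Sig : ι → ProjMap R)

/-- Generators of the universal localisation: the elements of `R`, and for every map
`α : P → Q` of the family, every `l` in `P* = Hom(P, R)` and every `q` in `Q`, a symbol standing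
for `l(α⁻¹(q))`. -/
inductive Gen : Type (max u w)
  | coeff (r : R) : Gen
  | inv (i : ι) (l : (Sig i).P →ₗ[Rᵐᵒᵖ] R) (q : (Sig i).Q) : Gen

/-- The generator `r` in the free ring. -/
def genR (r : R) : FreeAlgebra ℤ (Gen Sig) := FreeAlgebra.ι ℤ (Gen.coeff r)

/-- The generator `l(α⁻¹(q))` in the free ring. -/
def genInv (i : ι) (l : (Sig i).P →ₗ[Rᵐᵒᵖ] R) (q : (Sig i).Q) : FreeAlgebra ℤ (Gen Sig) :=
  FreeAlgebra.ι ℤ (Gen.inv i l q)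

/-- The defining relations of the universal localisation. The first three make `R → R_Σ` a ring
homomorphism, the next four make `l(α⁻¹(q))` additive and `R`-linear in both variables, and the
last two say `α⁻¹ α = 1` (tested on linear forms) and `α α⁻¹ = 1` (expanded along a dual basis
`∑ j, p j · l j (x) = x` of `P`). -/
inductive Rel : FreeAlgebra ℤ (Gen Sig) → FreeAlgebra ℤ (Gen Sig) → Prop
  | one : Rel (genR Sig 1) 1
  | add (r s : R) : Rel (genR Sig (r + s)) (genR Sig r + genR Sig s)
  | mul (r s : R) : Rel (genR Sig (r * s)) (genR Sig r * genR Sig s)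
  | inv_add (i : ι) (l : (Sig i).P →ₗ[Rᵐᵒᵖ] R) (q q' : (Sig i).Q) :
      Rel (genInv Sig i l (q + q')) (genInv Sig i l q + genInv Sig i l q')
  | inv_smul (i : ι) (l : (Sig i).P →ₗ[Rᵐᵒᵖ] R) (q : (Sig i).Q) (r : R) :
      Rel (genInv Sig i l (op r • q)) (genInv Sig i l q * genR Sig r)
  | add_inv (i : ι) (l l' : (Sig i).P →ₗ[Rᵐᵒᵖ] R) (q : (Sig i).Q) :
      Rel (genInv Sig i (l + l') q) (genInv Sig i l q + genInv Sig i l' q)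
  | smul_inv (i : ι) (l : (Sig i).P →ₗ[Rᵐᵒᵖ] R) (q : (Sig i).Q) (r : R) :
      Rel (genInv Sig i (r • l) q) (genR Sig r * genInv Sig i l q)
  | inv_hom (i : ι) (l : (Sig i).P →ₗ[Rᵐᵒᵖ] R) (p : (Sig i).P) :
      Rel (genInv Sig i l ((Sig i).hom p)) (genR Sig (l p))
  | hom_inv (i : ι) (n : ℕ) (p : Fin n → (Sig i).P) (l : Fin n → ((Sig i).P →ₗ[Rᵐᵒᵖ] R))
      (hpl : ∀ x, ∑ j, op (l j x) • p j = x) (k : (Sig i).Q →ₗ[Rᵐᵒᵖ] R) (q : (Sig i).Q) :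
      Rel (∑ j, genR Sig (k ((Sig i).hom (p j))) * genInv Sig i (l j) q) (genR Sig (k q))

/-- The universal localisation `R_Σ` of `R` at a family `Σ` of maps between finitely generated
projective modules, by generators and relations. See `inverts_toLoc` and `existsUnique_lift` for
its universal property. -/
abbrev Loc : Type (max u w) := RingQuot (Rel Sig)

/-- The canonical ring homomorphism `R → R_Σ`. -/
def toLoc : R →+* Loc Sig where
  toFun r := RingQuot.mkRingHom _ (genR Sig r)
  map_one' := by rw [RingQuot.mkRingHom_rel Rel.one, map_one]
  map_mul' r s := by rw [RingQuot.mkRingHom_rel (Rel.mul r s), map_mul]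
  map_add' r s := by rw [RingQuot.mkRingHom_rel (Rel.add r s), map_add]
  map_zero' := by
    have h := RingQuot.mkRingHom_rel (Rel.add (Sig := Sig) 0 0)
    rwa [map_add, add_zero, left_eq_add] at h

/-- The element `l(α⁻¹(q))` of `R_Σ`. -/
def invElt (i : ι) (l : (Sig i).P →ₗ[Rᵐᵒᵖ] R) (q : (Sig i).Q) : Loc Sig :=
  RingQuot.mkRingHom _ (genInv Sig i l q)

theorem exists_dualBasis (P : Type u) [AddCommGroup P] [Module Rᵐᵒᵖ P] [Module.Finite Rᵐᵒᵖ P]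
    [Module.Projective Rᵐᵒᵖ P] : ∃ (n : ℕ) (p : Fin n → P) (l : Fin n → (P →ₗ[Rᵐᵒᵖ] R)),
    ∀ x, ∑ j, op (l j x) • p j = x := by
  obtain ⟨n, f, g, -, -, hfg⟩ := Module.Finite.exists_comp_eq_id_of_projective Rᵐᵒᵖ P
  refine ⟨n, fun j => f (Pi.single j 1), fun j =>
    { toFun := fun x => (g x j).unop
      map_add' := by simp
      map_smul' := by simp [MulOpposite.smul_eq_mul_unop] }, fun x => ?_⟩
  have h : f (g x) = x := LinearMap.congr_fun hfg x
  conv_rhs => rw [← h, ← Finset.univ_sum_single (g x), map_sum]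
  refine Finset.sum_congr rfl fun j _ => ?_
  rw [← map_smul]
  congr 1
  ext k
  by_cases hk : k = j
  · subst hk; simp
  · simp [hk]

theorem sum_tmul_invElt {T : Type v} [Ring T] (g : R →+* T) (h : Loc Sig →+* T)
    (hg : h.comp (toLoc Sig) = g) (i : ι) (n : ℕ) (p : Fin n → (Sig i).P)
    (l : Fin n → ((Sig i).P →ₗ[Rᵐᵒᵖ] R)) (hpl : ∀ x, ∑ j, op (l j x) • p j = x) (y : (Sig i).Q) :
    ∑ j, Induced.tmul g ((Sig i).hom (p j)) (h (invElt Sig i (l j) y)) = Induced.tmul g y 1 := by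
  obtain ⟨m, q, k, hqk⟩ := exists_dualBasis (R := R) (Sig i).Q
  have h3 : ∀ x s, Induced.tmul g x s = ∑ a, Induced.tmul g (q a) (g (k a x) * s) := by
    intro x s
    have e : Induced.tmul g x s = op s • Induced.unit g (Sig i).Q x := by
      change _ = op s • Induced.tmul g x 1
      rw [Induced.smul_tmul, one_mul]
    rw [e]
    conv_lhs => rw [← hqk x, map_sum, Finset.smul_sum]
    refine Finset.sum_congr rfl fun a _ => ?_
    change op s • Induced.tmul g (op (k a x) • q a) 1 = _
    rw [Induced.tmul_smul, Induced.smul_tmul, mul_one]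
  have h4 : ∀ a (J : Finset (Fin n)) (s : Fin n → T),
      Induced.tmul g (q a) (∑ j ∈ J, s j) = ∑ j ∈ J, Induced.tmul g (q a) (s j) := by
    intro a J s
    exact map_sum (AddMonoidHom.mk' (Induced.tmul g (q a)) (Induced.tmul_add _ (q a))) s J
  rw [h3 y 1, Finset.sum_congr rfl fun j _ => h3 ((Sig i).hom (p j)) (h (invElt Sig i (l j) y)),
    Finset.sum_comm]
  refine Finset.sum_congr rfl fun a _ => ?_
  rw [← h4, mul_one]
  congr 1
  have := congrArg h (RingQuot.mkRingHom_rel (Rel.hom_inv i n p l hpl (k a) y))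
  rw [map_sum, map_sum] at this
  subst hg
  refine (Finset.sum_congr rfl fun j _ => ?_).trans this
  rw [map_mul, map_mul]
  rfl

/-- `R → R_Σ` inverts every map of the family. -/
theorem inverts_toLoc (i : ι) : Inverts (toLoc Sig) (Sig i) := by
  obtain ⟨n, p, l, hpl⟩ := exists_dualBasis (R := R) (Sig i).P
  let β : Induced (toLoc Sig) (Sig i).Q →ₗ[(Loc Sig)ᵐᵒᵖ] Induced (toLoc Sig) (Sig i).P :=
    Induced.lift _ (AddMonoidHom.mk'
      (fun y => ∑ j, Induced.tmul (toLoc Sig) (p j) (invElt Sig i (l j) y)) (by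
        intro a b
        rw [← Finset.sum_add_distrib]
        refine Finset.sum_congr rfl fun j _ => ?_
        rw [← Induced.tmul_add, invElt, RingQuot.mkRingHom_rel (Rel.inv_add i (l j) a b), map_add]
        rfl)) (by
        intro y r
        simp only [AddMonoidHom.mk'_apply, Finset.smul_sum, Induced.smul_tmul]
        refine Finset.sum_congr rfl fun j _ => ?_
        rw [invElt, RingQuot.mkRingHom_rel (Rel.inv_smul i (l j) y r), map_mul]
        rfl)
  have hβ : ∀ y, β (Induced.tmul _ y 1) =
      ∑ j, Induced.tmul (toLoc Sig) (p j) (invElt Sig i (l j) y) := by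
    intro y
    rw [Induced.lift_tmul, op_one, one_smul]
    rfl
  have h1 : β ∘ₗ Induced.map (toLoc Sig) (Sig i).hom = LinearMap.id := by
    refine Induced.hom_ext _ fun x => ?_
    rw [LinearMap.comp_apply, Induced.map_tmul, hβ, LinearMap.id_apply]
    have : ∀ j, Induced.tmul (toLoc Sig) (p j) (invElt Sig i (l j) ((Sig i).hom x)) =
        Induced.unit (toLoc Sig) (Sig i).P (op (l j x) • p j) := by
      intro j
      change _ = Induced.tmul (toLoc Sig) (op (l j x) • p j) 1
      rw [Induced.tmul_smul, mul_one, invElt, RingQuot.mkRingHom_rel (Rel.inv_hom i (l j) x)]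
      rfl
    rw [Finset.sum_congr rfl fun j _ => this j, ← map_sum, hpl]
    rfl
  have h2 : Induced.map (toLoc Sig) (Sig i).hom ∘ₗ β = LinearMap.id := by
    refine Induced.hom_ext _ fun y => ?_
    rw [LinearMap.comp_apply, hβ, map_sum, LinearMap.id_apply]
    simp only [Induced.map_tmul]
    exact sum_tmul_invElt Sig _ (RingHom.id _) (RingHom.id_comp _) i n p l hpl y
  exact ⟨Function.LeftInverse.injective (LinearMap.congr_fun h1),
    Function.RightInverse.surjective (LinearMap.congr_fun h2)⟩

/-- The map `P ⊗_R T → T`, `p ⊗ t ↦ l(p) t`, of a linear form `l` on `P`. -/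
def evalForm {T : Type v} [Ring T] (g : R →+* T) {P : Type u} [AddCommGroup P] [Module Rᵐᵒᵖ P]
    (l : P →ₗ[Rᵐᵒᵖ] R) : Induced g P →ₗ[Tᵐᵒᵖ] T :=
  Induced.lift g (g.toAddMonoidHom.comp l.toAddMonoidHom) (by
    intro m r
    change g (l (op r • m)) = g (l m) * g r
    rw [map_smul, ← map_mul]; rfl)

theorem evalForm_tmul {T : Type v} [Ring T] (g : R →+* T) {P : Type u} [AddCommGroup P]
    [Module Rᵐᵒᵖ P] (l : P →ₗ[Rᵐᵒᵖ] R) (p : P) (t : T) :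
    evalForm g l (Induced.tmul g p t) = g (l p) * t := rfl

/-- `R → R_Σ` is universal among the ring homomorphisms inverting every map of the family. -/
theorem existsUnique_lift {T : Type v} [Ring T] (g : R →+* T) (hg : ∀ i, Inverts g (Sig i)) :
    ∃! h : Loc Sig →+* T, h.comp (toLoc Sig) = g := by
  have heq : ∀ i (y : (Sig i).Q), ∃ z : Induced g (Sig i).P,
      Induced.map g (Sig i).hom z = Induced.tmul g y 1 := fun i y => (hg i).2 _
  choose β hβ using heq
  let F : FreeAlgebra ℤ (Gen Sig) →ₐ[ℤ] T := FreeAlgebra.lift ℤ fun x =>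
    match x with
    | Gen.coeff r => g r
    | Gen.inv i l q => evalForm g l (β i q)
  have F1 : ∀ r, F (genR Sig r) = g r := fun r => FreeAlgebra.lift_ι_apply _ _
  have F2 : ∀ i l q, F (genInv Sig i l q) = evalForm g l (β i q) :=
    fun i l q => FreeAlgebra.lift_ι_apply _ _
  have ev_add : ∀ (i : ι) (l l' : (Sig i).P →ₗ[Rᵐᵒᵖ] R),
      evalForm g (l + l') = evalForm g l + evalForm g l' := fun i l l' =>
    Induced.hom_ext _ fun m => by simp [evalForm_tmul]
  have ev_smul : ∀ (i : ι) (l : (Sig i).P →ₗ[Rᵐᵒᵖ] R) (r : R) (z : Induced g (Sig i).P),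
      evalForm g (r • l) z = g r * evalForm g l z := fun i l r z => by
    have : evalForm g (r • l) = g r • evalForm g l :=
      Induced.hom_ext _ fun m => by simp [evalForm_tmul]
    rw [this]; rfl
  have hF : ∀ ⦃x y⦄, Rel Sig x y → (F : FreeAlgebra ℤ (Gen Sig) →+* T) x =
      (F : FreeAlgebra ℤ (Gen Sig) →+* T) y := by
    intro x y hxy
    simp only [RingHom.coe_coe]
    induction hxy with
    | one => simp [F1]
    | add r s => simp [F1]
    | mul r s => simp [F1]
    | inv_add i l q q' =>
      have : β i (q + q') = β i q + β i q' := (hg i).1 (by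
        rw [hβ, map_add, hβ, hβ, Induced.add_tmul])
      rw [map_add, F2, F2, F2, this, map_add]
    | inv_smul i l q r =>
      have : β i (op r • q) = op (g r) • β i q := (hg i).1 (by
        rw [hβ, map_smul, hβ, Induced.tmul_smul, Induced.smul_tmul, one_mul, mul_one])
      rw [map_mul, F2, F2, F1, this, map_smul]; rfl
    | add_inv i l l' q => rw [map_add, F2, F2, F2, ev_add]; rfl
    | smul_inv i l q r => rw [map_mul, F2, F2, F1, ev_smul]
    | inv_hom i l p =>
      have : β i ((Sig i).hom p) = Induced.tmul g p 1 := (hg i).1 (by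
        rw [hβ, Induced.map_tmul])
      rw [F2, F1, this, evalForm_tmul, mul_one]
    | hom_inv i n p l hpl k q =>
      have e : ∑ j, g (k ((Sig i).hom (p j))) • evalForm g (l j) =
          evalForm g k ∘ₗ Induced.map g (Sig i).hom := Induced.hom_ext _ fun x => by
        rw [LinearMap.sum_apply, LinearMap.comp_apply, Induced.map_tmul]
        simp only [LinearMap.smul_apply, evalForm_tmul, mul_one, smul_eq_mul]
        conv_rhs => rw [← hpl x]
        simp only [map_sum, map_smul]
        refine Finset.sum_congr rfl fun j _ => ?_
        rw [← map_mul]; rfl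
      have e2 := LinearMap.congr_fun e (β i q)
      rw [LinearMap.sum_apply, LinearMap.comp_apply, hβ, evalForm_tmul, mul_one] at e2
      rw [map_sum, F1, ← e2]
      refine Finset.sum_congr rfl fun j _ => ?_
      rw [map_mul, F1, F2]; rfl
  refine ⟨RingQuot.lift ⟨F, hF⟩, ?_, ?_⟩
  · ext r
    change RingQuot.lift ⟨F, hF⟩ (RingQuot.mkRingHom _ (genR Sig r)) = g r
    rw [RingQuot.lift_mkRingHom_apply]
    exact F1 r
  · intro h hh
    have hinv : ∀ i l q, h (invElt Sig i l q) = evalForm g l (β i q) := by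
      intro i l q
      obtain ⟨n, p, e, hpe⟩ := exists_dualBasis (R := R) (Sig i).P
      have : β i q = ∑ j, Induced.tmul g (p j) (h (invElt Sig i (e j) q)) := (hg i).1 (by
        rw [hβ, map_sum]
        simp only [Induced.map_tmul]
        exact (sum_tmul_invElt Sig g h hh i n p e hpe q).symm)
      rw [this, map_sum]
      have hl : l = ∑ j, l (p j) • e j := by
        ext x
        conv_lhs => rw [← hpe x]
        rw [map_sum, LinearMap.sum_apply]
        refine Finset.sum_congr rfl fun j _ => ?_
        rw [map_smul]; rfl
      let A : ((Sig i).P →ₗ[Rᵐᵒᵖ] R) →+ Loc Sig := AddMonoidHom.mk' (fun l => invElt Sig i l q)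
        (fun l l' => by
          rw [invElt, RingQuot.mkRingHom_rel (Rel.add_inv i l l' q), map_add]; rfl)
      have hA : ∀ (r : R) l, A (r • l) = toLoc Sig r * A l := fun r l => by
        change invElt Sig i (r • l) q = _
        rw [invElt, RingQuot.mkRingHom_rel (Rel.smul_inv i l q r), map_mul]; rfl
      change h (A l) = _
      conv_lhs => rw [hl, map_sum, map_sum]
      refine Finset.sum_congr rfl fun j _ => ?_
      rw [hA, map_mul, evalForm_tmul, ← hh]; rfl
    refine RingQuot.ringQuot_ext _ _ ?_
    suffices H : ((h.comp (RingQuot.mkRingHom (Rel Sig))).toIntAlgHom) = F by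
      ext x
      rw [RingHom.comp_apply, RingHom.comp_apply, RingQuot.lift_mkRingHom_apply]
      exact DFunLike.congr_fun H x
    refine FreeAlgebra.hom_ext (funext fun x => ?_)
    cases x with
    | coeff r => exact (RingHom.congr_fun hh r).trans (F1 r).symm
    | inv i l q => exact (hinv i l q).trans (F2 i l q).symm

end Localisation

section Torsion

variable {R : Type u} [Ring R]

/-- `F` is torsion-free for the torsion theory generated by `E`. -/
def IsTorsionFree (E : ObjectProperty (ModuleCat.{u} Rᵐᵒᵖ)) (F : Type u) [AddCommGroup F]
    [Module Rᵐᵒᵖ F] : Prop :=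
  ∀ N : ModuleCat.{u} Rᵐᵒᵖ, E N → ∀ φ : N →ₗ[Rᵐᵒᵖ] F, φ = 0

/-- `T` is torsion for the torsion theory generated by `E`. -/
def IsTorsion (E : ObjectProperty (ModuleCat.{u} Rᵐᵒᵖ)) (T : Type u) [AddCommGroup T]
    [Module Rᵐᵒᵖ T] : Prop :=
  ∀ (F : Type u) [AddCommGroup F] [Module Rᵐᵒᵖ F], IsTorsionFree E F →
    ∀ φ : T →ₗ[Rᵐᵒᵖ] F, φ = 0

/-- The torsion submodule of `M`: the sum of all its torsion submodules. -/
def torsionSubmodule (E : ObjectProperty (ModuleCat.{u} Rᵐᵒᵖ)) (M : Type u) [AddCommGroup M]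
    [Module Rᵐᵒᵖ M] : Submodule Rᵐᵒᵖ M :=
  sSup {N | IsTorsion E N}

/-- The torsion submodule is the largest torsion submodule. -/
theorem isGreatest_torsionSubmodule (E : ObjectProperty (ModuleCat.{u} Rᵐᵒᵖ)) (M : Type u)
    [AddCommGroup M] [Module Rᵐᵒᵖ M] :
    IsGreatest {N : Submodule Rᵐᵒᵖ M | IsTorsion E N} (torsionSubmodule E M) := by
  refine ⟨?_, fun N hN => le_sSup hN⟩
  intro F _ _ hF φ
  have hle : torsionSubmodule E M ≤
      (LinearMap.ker φ).map (torsionSubmodule E M).subtype := by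
    refine sSup_le fun N hN x hx => ?_
    have h := hN F hF (φ ∘ₗ Submodule.inclusion (le_sSup hN))
    exact ⟨⟨x, le_sSup hN hx⟩, LinearMap.congr_fun h ⟨x, hx⟩, rfl⟩
  ext ⟨x, hx⟩
  obtain ⟨y, hy, rfl⟩ := hle hx
  exact hy

/-- `0 → A → B → C → 0` is a short exact sequence of right `R`-modules. -/
def IsShortExact {A B C : ModuleCat.{u} Rᵐᵒᵖ} (a : A →ₗ[Rᵐᵒᵖ] B) (b : B →ₗ[Rᵐᵒᵖ] C) : Prop :=
  Function.Injective a ∧ Function.Exact a b ∧ Function.Surjective b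

/-- Pre-localising subcategories of the category of finitely presented right `R`-modules, given
by the property of being an object. The closure conditions on cokernels, images and kernels are
only required when the cokernel has homological dimension exactly `1`; requiring them also in
dimension `0` would give a smaller class of subcategories. Any two isomorphic
modules lie in `E` together, see `IsPreLocalising.of_equiv`. -/
structure IsPreLocalising (E : ObjectProperty (ModuleCat.{u} Rᵐᵒᵖ)) : Prop where
  finitePresentation : ∀ A, E A → Module.FinitePresentation Rᵐᵒᵖ A
  dimension_le_one : ∀ A, E A → HasProjectiveDimensionLE A 1
  extension : ∀ {A B C : ModuleCat.{u} Rᵐᵒᵖ} (a : A →ₗ[Rᵐᵒᵖ] B) (b : B →ₗ[Rᵐᵒᵖ] C),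
    IsShortExact a b → E A → E C → E B
  kernel_of_surjective : ∀ {A B C : ModuleCat.{u} Rᵐᵒᵖ} (a : A →ₗ[Rᵐᵒᵖ] B) (b : B →ₗ[Rᵐᵒᵖ] C),
    IsShortExact a b → E B → E C → E A
  cokernel_of_injective : ∀ {A B C : ModuleCat.{u} Rᵐᵒᵖ} (a : A →ₗ[Rᵐᵒᵖ] B) (b : B →ₗ[Rᵐᵒᵖ] C),
    IsShortExact a b → E A → E B → projectiveDimension C = 1 → E C
  cokernel : ∀ {A B : ModuleCat.{u} Rᵐᵒᵖ} (φ : A →ₗ[Rᵐᵒᵖ] B), E A → E B →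
    projectiveDimension (ModuleCat.of Rᵐᵒᵖ (B ⧸ LinearMap.range φ)) = 1 →
    E (ModuleCat.of Rᵐᵒᵖ (B ⧸ LinearMap.range φ))
  image : ∀ {A B : ModuleCat.{u} Rᵐᵒᵖ} (φ : A →ₗ[Rᵐᵒᵖ] B), E A → E B →
    projectiveDimension (ModuleCat.of Rᵐᵒᵖ (B ⧸ LinearMap.range φ)) = 1 →
    Module.FinitePresentation Rᵐᵒᵖ (LinearMap.range φ) →
    E (ModuleCat.of Rᵐᵒᵖ (LinearMap.range φ))
  kernel : ∀ {A B : ModuleCat.{u} Rᵐᵒᵖ} (φ : A →ₗ[Rᵐᵒᵖ] B), E A → E B →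
    projectiveDimension (ModuleCat.of Rᵐᵒᵖ (B ⧸ LinearMap.range φ)) = 1 →
    Module.FinitePresentation Rᵐᵒᵖ (LinearMap.ker φ) →
    E (ModuleCat.of Rᵐᵒᵖ (LinearMap.ker φ))

theorem IsPreLocalising.of_equiv {E : ObjectProperty (ModuleCat.{u} Rᵐᵒᵖ)}
    (hE : IsPreLocalising E) {A B : ModuleCat.{u} Rᵐᵒᵖ} (e : A ≃ₗ[Rᵐᵒᵖ] B) (hA : E A) : E B := by
  have h0 : E (ModuleCat.of Rᵐᵒᵖ PUnit) :=
    hE.kernel_of_surjective (A := ModuleCat.of Rᵐᵒᵖ PUnit) (B := A) (C := A) 0 LinearMap.id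
      ⟨fun _ _ _ => rfl, fun x => ⟨fun h => ⟨0, by simpa using h.symm⟩, by
        rintro ⟨y, rfl⟩; simp⟩, fun x => ⟨x, rfl⟩⟩ hA hA
  exact hE.extension (A := A) (B := B) (C := ModuleCat.of Rᵐᵒᵖ PUnit) e.toLinearMap 0
    ⟨e.injective, fun x => ⟨fun _ => e.surjective x, fun _ => rfl⟩, fun x => ⟨0, rfl⟩⟩ hA h0

/-- The family `Sig` consists of injective maps between finitely generated projective modules
and its cokernels are, up to isomorphism, exactly the modules in `E`. The ring `R_E` is then
`Loc Sig`. -/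
structure Presents {ι : Type w} (Sig : ι → ProjMap R) (E : ObjectProperty (ModuleCat.{u} Rᵐᵒᵖ)) :
    Prop where
  injective : ∀ i, Function.Injective (Sig i).hom
  cokernel_mem : ∀ i, E (ModuleCat.of Rᵐᵒᵖ ((Sig i).Q ⧸ LinearMap.range (Sig i).hom))
  exists_equiv : ∀ A, E A → ∃ i, Nonempty (A ≃ₗ[Rᵐᵒᵖ] (Sig i).Q ⧸ LinearMap.range (Sig i).hom)

/-- Every pre-localising subcategory is presented by some small family. -/
theorem IsPreLocalising.exists_presents {E : ObjectProperty (ModuleCat.{u} Rᵐᵒᵖ)}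
    (hE : IsPreLocalising E) : ∃ (ι : Type u) (Sig : ι → ProjMap R), Presents Sig E := by
  let ι : Type u := Σ n : ℕ, {K : Submodule Rᵐᵒᵖ (Fin n → Rᵐᵒᵖ) // Module.Finite Rᵐᵒᵖ K ∧
    Module.Projective Rᵐᵒᵖ K ∧ E (ModuleCat.of Rᵐᵒᵖ ((Fin n → Rᵐᵒᵖ) ⧸ K))}
  let Sig : ι → ProjMap R := fun i =>
    haveI := i.2.2.1
    haveI := i.2.2.2.1
    { P := i.2.1, Q := Fin i.1 → Rᵐᵒᵖ, hom := i.2.1.subtype }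
  have hr : ∀ i, LinearMap.range (Sig i).hom = i.2.1 := fun i => Submodule.range_subtype _
  refine ⟨ι, Sig, fun i => Submodule.injective_subtype _, fun i => ?_, fun A hA => ?_⟩
  · rw [hr]; exact i.2.2.2.2
  · have := hE.finitePresentation A hA
    obtain ⟨n, K, e, hK⟩ := Module.FinitePresentation.exists_fin Rᵐᵒᵖ A
    have hEK : E (ModuleCat.of Rᵐᵒᵖ ((Fin n → Rᵐᵒᵖ) ⧸ K)) :=
      hE.of_equiv (B := ModuleCat.of Rᵐᵒᵖ _) e hA
    have hproj : Module.Projective Rᵐᵒᵖ K := by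
      let S : ShortComplex (ModuleCat.{u} Rᵐᵒᵖ) :=
        ShortComplex.mk (ModuleCat.ofHom K.subtype) (ModuleCat.ofHom K.mkQ) (by ext; simp)
      have hS : S.ShortExact := ModuleCat.shortComplex_shortExact S
        (LinearMap.exact_subtype_mkQ K) K.injective_subtype K.mkQ_surjective
      have h1 := hE.dimension_le_one _ hEK
      have hp : Projective S.X₂ :=
        (IsProjective.iff_projective (R := Rᵐᵒᵖ) (Fin n → Rᵐᵒᵖ)).mp inferInstance
      have := (hS.hasProjectiveDimensionLT_X₃_iff 0 hp).mp h1
      have h3 := projective_iff_hasProjectiveDimensionLT_one.mpr this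
      exact (IsProjective.iff_projective (R := Rᵐᵒᵖ) K).mpr h3
    let i : ι := ⟨n, K, Module.Finite.iff_fg.mpr hK, hproj, hEK⟩
    exact ⟨i, ⟨e.trans (Submodule.quotEquivOfEq _ _ (hr i).symm)⟩⟩

end Torsion

end

end UnivLoc

/-! Write `t` for the torsion submodule of `M`. The inclusion of `t` in the kernel is formal: `M ⊗
R_Σ` receives no nonzero map from an object `N = Q / P` of `E`. Such a map gives a map `Q ⊗ R_Σ → M
⊗ R_Σ` vanishing on the image of `P ⊗ R_Σ`, which is everything. Hence `M / ker` is torsion-free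
(`isTorsionFree_quotient_ker_unit`).

For the converse, the torsion-free module `M / t` is embedded in a torsion-free module `X` such that
every map `P → X` extends along each `P → Q` in `Σ` (`IsPreLocalising.exists_hull`). The extension
is unique because `X` is torsion-free. Bijectivity of `Hom(Q, X) → Hom(P, X)` for all of `Σ` makes
the ring map from `R` to the (opposite) additive endomorphisms of `X` invert `Σ`
(`inverts_toEndOp`). So `X` is an `R_Σ`-module, and `M → M / t → X`, whose kernel is `t`, factors
through `M ⊗ R_Σ` (`ker_unit_le_ker`).

The hypothesis on kernels enters in the construction of `X`. Pushing out a torsion-free module `M`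
along a direct sum of maps of `Σ` solves all extension problems for `M`, and gives `Y ⊇ M` with `Y /
M` a direct sum of objects of `E`. The module `Y` may have torsion, but torsion modules are unions
of images of objects of `E` (`IsTorsion.exists_mem_range`), so the kernel of the map from the
torsion of `Y` to `Y / M` is again torsion. That kernel lies in `M`, so it is zero, and `M` embeds
in the quotient of `Y` by its torsion. Iterating countably often gives `X`, since the modules `P`
and the objects of `E` are finitely generated. -/

namespace UnivLoc

/-! ### Lifting maps from projective modules. -/

section Lifting

variable {A : Type*} [Ring A] {P X Y : Type*} [AddCommGroup P] [Module A P] [AddCommGroup X]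
  [Module A X] [AddCommGroup Y] [Module A Y]

/-- A map from a projective module lifts through any map whose range contains its range. -/
theorem exists_lift_of_range_le [Module.Projective A P] (f : P →ₗ[A] Y) (g : X →ₗ[A] Y)
    (h : LinearMap.range f ≤ LinearMap.range g) : ∃ k : P →ₗ[A] X, g ∘ₗ k = f := by
  obtain ⟨k, hk⟩ := Module.projective_lifting_property g.rangeRestrict
    (f.codRestrict (LinearMap.range g) fun x => h ⟨x, rfl⟩) g.surjective_rangeRestrict
  exact ⟨k, LinearMap.ext fun x => congrArg Subtype.val (LinearMap.congr_fun hk x)⟩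

end Lifting

/-! ### Formal properties of the torsion theory. -/

section TorsionTheory

variable {R : Type u} [Ring R] {E : ObjectProperty (ModuleCat.{u} Rᵐᵒᵖ)}

theorem IsTorsionFree.of_injective {F G : Type u} [AddCommGroup F] [Module Rᵐᵒᵖ F]
    [AddCommGroup G] [Module Rᵐᵒᵖ G] (hG : IsTorsionFree E G) (j : F →ₗ[Rᵐᵒᵖ] G)
    (hj : Function.Injective j) : IsTorsionFree E F := fun N hN φ => by
  ext x
  exact hj (by simpa using LinearMap.congr_fun (hG N hN (j ∘ₗ φ)) x)

theorem IsTorsion.of_mem {N : ModuleCat.{u} Rᵐᵒᵖ} (hN : E N) : IsTorsion E N :=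
  fun _ _ _ hF φ => hF N hN φ

theorem IsTorsion.of_surjective {S T : Type u} [AddCommGroup S] [Module Rᵐᵒᵖ S]
    [AddCommGroup T] [Module Rᵐᵒᵖ T] (hS : IsTorsion E S) (p : S →ₗ[Rᵐᵒᵖ] T)
    (hp : Function.Surjective p) : IsTorsion E T := fun F _ _ hF φ => by
  ext x
  obtain ⟨y, rfl⟩ := hp x
  exact LinearMap.congr_fun (hS F hF (φ ∘ₗ p)) y

/-- An extension of torsion modules is torsion. -/
theorem IsTorsion.of_exact {S T U : Type u} [AddCommGroup S] [Module Rᵐᵒᵖ S] [AddCommGroup T]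
    [Module Rᵐᵒᵖ T] [AddCommGroup U] [Module Rᵐᵒᵖ U] (hS : IsTorsion E S) (hU : IsTorsion E U)
    (a : S →ₗ[Rᵐᵒᵖ] T) (b : T →ₗ[Rᵐᵒᵖ] U) (hab : LinearMap.ker b ≤ LinearMap.range a)
    (hb : Function.Surjective b) : IsTorsion E T := fun F _ _ hF φ => by
  have hφ : LinearMap.ker b ≤ LinearMap.ker φ := fun x hx => by
    obtain ⟨y, rfl⟩ := hab hx
    exact LinearMap.congr_fun (hS F hF (φ ∘ₗ a)) y
  -- `φ` kills the image of `S`, so it descends to `T / ker b ≅ U`.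
  have h := hU F hF ((LinearMap.ker b).liftQ φ hφ ∘ₗ (b.quotKerEquivOfSurjective hb).symm)
  ext x
  have hx := LinearMap.congr_fun h (b x)
  rw [LinearMap.comp_apply, LinearEquiv.coe_coe,
    (b.quotKerEquivOfSurjective hb).symm_apply_eq.mpr
      (show b x = b.quotKerEquivOfSurjective hb (Submodule.Quotient.mk x) from rfl)] at hx
  exact hx

theorem IsTorsion.le_torsionSubmodule {M : Type u} [AddCommGroup M] [Module Rᵐᵒᵖ M]
    {N : Submodule Rᵐᵒᵖ M} (hN : IsTorsion E N) : N ≤ torsionSubmodule E M :=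
  (isGreatest_torsionSubmodule E M).2 hN

variable (E) in
theorem isTorsion_torsionSubmodule (M : Type u) [AddCommGroup M] [Module Rᵐᵒᵖ M] :
    IsTorsion E (torsionSubmodule E M) :=
  (isGreatest_torsionSubmodule E M).1

theorem IsTorsionFree.torsionSubmodule_eq_bot {M : Type u} [AddCommGroup M] [Module Rᵐᵒᵖ M]
    (hM : IsTorsionFree E M) : torsionSubmodule E M = ⊥ :=
  (Submodule.eq_bot_iff _).mpr fun x hx => LinearMap.congr_fun
    (isTorsion_torsionSubmodule E M M hM (torsionSubmodule E M).subtype) ⟨x, hx⟩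

-- The preimage in `M` of the image of an object of `E` is an extension of a torsion module by the
-- torsion submodule, hence torsion, hence already inside the torsion submodule.
variable (E) in
theorem isTorsionFree_quotient_torsionSubmodule (M : Type u) [AddCommGroup M] [Module Rᵐᵒᵖ M] :
    IsTorsionFree E (M ⧸ torsionSubmodule E M) := by
  set t := torsionSubmodule E M
  intro N hN φ
  let T : Submodule Rᵐᵒᵖ M := (LinearMap.range φ).comap t.mkQ
  have hT : IsTorsion E T := by
    refine IsTorsion.of_exact (isTorsion_torsionSubmodule E M)
      ((IsTorsion.of_mem hN).of_surjective φ.rangeRestrict φ.surjective_rangeRestrict)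
      (Submodule.inclusion (fun x hx => ?_ : t ≤ T))
      ((t.mkQ ∘ₗ T.subtype).codRestrict (LinearMap.range φ) fun x => x.2) ?_ ?_
    · exact ⟨0, by rw [map_zero]; exact ((Submodule.Quotient.mk_eq_zero t).mpr hx).symm⟩
    · intro x hx
      have hx' : t.mkQ x = 0 := congrArg Subtype.val hx
      exact ⟨⟨x, (Submodule.Quotient.mk_eq_zero t).mp hx'⟩, rfl⟩
    · rintro ⟨y, hy⟩
      obtain ⟨x, rfl⟩ := t.mkQ_surjective y
      exact ⟨⟨x, hy⟩, rfl⟩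
  ext n
  obtain ⟨x, hx⟩ := t.mkQ_surjective (φ n)
  rw [← hx]
  exact (Submodule.Quotient.mk_eq_zero t).mpr (hT.le_torsionSubmodule ⟨n, hx.symm⟩)

theorem Presents.exists_surjective {ι : Type w} {Sig : ι → ProjMap R} (hSig : Presents Sig E)
    {N : ModuleCat.{u} Rᵐᵒᵖ} (hN : E N) : ∃ (i : ι) (π : (Sig i).Q →ₗ[Rᵐᵒᵖ] N),
      Function.Surjective π ∧ LinearMap.ker π = LinearMap.range (Sig i).hom := by
  obtain ⟨i, ⟨e⟩⟩ := hSig.exists_equiv N hN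
  refine ⟨i, e.symm.toLinearMap ∘ₗ Submodule.mkQ _,
    e.symm.surjective.comp (Submodule.mkQ_surjective _), ?_⟩
  rw [LinearEquiv.ker_comp, Submodule.ker_mkQ]

/-! ### Torsion modules as unions of images of objects of `E`, and torsion kernels. -/

variable (hE : IsPreLocalising E)
include hE

theorem IsPreLocalising.prod {A B : ModuleCat.{u} Rᵐᵒᵖ} (hA : E A) (hB : E B) :
    E (ModuleCat.of Rᵐᵒᵖ (A × B)) :=
  hE.extension (B := ModuleCat.of Rᵐᵒᵖ (A × B)) (LinearMap.inl Rᵐᵒᵖ A B) (LinearMap.snd Rᵐᵒᵖ A B)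
    ⟨LinearMap.inl_injective, LinearMap.exact_iff.mpr (LinearMap.range_inl Rᵐᵒᵖ A B).symm,
      LinearMap.snd_surjective⟩ hA hB

/-- The pushout of an object `N` of `E` along a map from `P`, where `P → Q` is injective with
cokernel in `E`, lies in `E`. -/
theorem IsPreLocalising.pushout {N N' : ModuleCat.{u} Rᵐᵒᵖ} (hN : E N) (hN' : E N')
    {P Q : Type u} [AddCommGroup P] [Module Rᵐᵒᵖ P] [AddCommGroup Q] [Module Rᵐᵒᵖ Q]
    (σ : P →ₗ[Rᵐᵒᵖ] Q) (hσ : Function.Injective σ) (π : Q →ₗ[Rᵐᵒᵖ] N')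
    (hπ : Function.Surjective π) (hπσ : LinearMap.ker π = LinearMap.range σ) (l : P →ₗ[Rᵐᵒᵖ] N) :
    E (ModuleCat.of Rᵐᵒᵖ ((N × Q) ⧸ LinearMap.range (l.prod (-σ)))) := by
  have hz : LinearMap.range (l.prod (-σ)) ≤ LinearMap.ker (π ∘ₗ LinearMap.snd Rᵐᵒᵖ N Q) := by
    rintro _ ⟨p, rfl⟩
    have : π (σ p) = 0 := (hπσ ▸ LinearMap.mem_range_self σ p : σ p ∈ LinearMap.ker π)
    simp [this]
  -- The pushout is an extension `0 → N → (N × Q) / P → N' → 0`; injectivity on the left comes from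
  -- that of `σ`.
  refine hE.extension (B := ModuleCat.of Rᵐᵒᵖ ((N × Q) ⧸ LinearMap.range (l.prod (-σ))))
    (Submodule.mkQ _ ∘ₗ LinearMap.inl Rᵐᵒᵖ N Q) (Submodule.liftQ _ _ hz) ⟨?_, ?_, ?_⟩ hN hN'
  · refine (injective_iff_map_eq_zero _).mpr fun n hn => ?_
    obtain ⟨p, hp⟩ := (Submodule.Quotient.mk_eq_zero _).mp hn
    have h1 : l p = n := congrArg Prod.fst hp
    have h2 : -σ p = 0 := congrArg Prod.snd hp
    rw [← h1, (map_eq_zero_iff σ hσ).mp (neg_eq_zero.mp h2), map_zero]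
  · intro y
    obtain ⟨⟨n, q⟩, rfl⟩ := Submodule.mkQ_surjective _ y
    constructor
    · intro hy
      obtain ⟨p, hp⟩ : q ∈ LinearMap.range σ := hπσ ▸ (show π q = 0 from hy)
      -- In the pushout `(n, σ p)` and `(n + l p, 0)` are the same element.
      refine ⟨n + l p, (Submodule.Quotient.eq _).mpr ⟨p, ?_⟩⟩
      ext <;> simp [hp]
    · rintro ⟨n', h⟩
      rw [← h]
      exact map_zero π
  · intro y
    obtain ⟨q, rfl⟩ := hπ y
    exact ⟨Submodule.Quotient.mk (0, q), rfl⟩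

/-- A torsion module is the directed union of the images of the objects of `E`. -/
theorem IsTorsion.exists_mem_range {T : Type u} [AddCommGroup T] [Module Rᵐᵒᵖ T]
    (hT : IsTorsion E T) {N₀ : ModuleCat.{u} Rᵐᵒᵖ} (hN₀ : E N₀) (x : T) :
    ∃ N : ModuleCat.{u} Rᵐᵒᵖ, E N ∧ ∃ φ : N →ₗ[Rᵐᵒᵖ] T, x ∈ LinearMap.range φ := by
  have hsup : ∀ {N N' : ModuleCat.{u} Rᵐᵒᵖ}, E N → E N' → ∀ (φ : N →ₗ[Rᵐᵒᵖ] T)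
      (φ' : N' →ₗ[Rᵐᵒᵖ] T), ∃ N'' : ModuleCat.{u} Rᵐᵒᵖ, E N'' ∧ ∃ φ'' : N'' →ₗ[Rᵐᵒᵖ] T,
        LinearMap.range φ ⊔ LinearMap.range φ' ≤ LinearMap.range φ'' :=
    fun hN hN' φ φ' => ⟨_, hE.prod hN hN', φ.coprod φ', (LinearMap.range_coprod φ φ').ge⟩
  let T' : Submodule Rᵐᵒᵖ T :=
    { carrier := {x | ∃ N : ModuleCat.{u} Rᵐᵒᵖ, E N ∧ ∃ φ : N →ₗ[Rᵐᵒᵖ] T, x ∈ LinearMap.range φ}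
      add_mem' := by
        rintro x y ⟨N, hN, φ, hx⟩ ⟨N', hN', φ', hy⟩
        obtain ⟨N'', hN'', φ'', h⟩ := hsup hN hN' φ φ'
        exact ⟨N'', hN'', φ'', h (Submodule.add_mem_sup hx hy)⟩
      -- `E` could be empty, so some object `N₀` has to be supplied.
      zero_mem' := ⟨N₀, hN₀, 0, zero_mem _⟩
      smul_mem' := by
        rintro r x ⟨N, hN, φ, hx⟩
        exact ⟨N, hN, φ, Submodule.smul_mem _ r hx⟩ }
  have hfg : ∀ L : Submodule Rᵐᵒᵖ T, L.FG → L ≤ T' →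
      ∃ N : ModuleCat.{u} Rᵐᵒᵖ, E N ∧ ∃ φ : N →ₗ[Rᵐᵒᵖ] T, L ≤ LinearMap.range φ := by
    intro L hL
    induction L, hL using Submodule.fg_induction with
    | singleton x =>
      intro h
      obtain ⟨N, hN, φ, hx⟩ := h (Submodule.mem_span_singleton_self x)
      exact ⟨N, hN, φ, (Submodule.span_singleton_le_iff_mem _ _).mpr hx⟩
    | sup L L' _ _ hL hL' =>
      intro h
      obtain ⟨N, hN, φ, hφ⟩ := hL (le_sup_left.trans h)
      obtain ⟨N', hN', φ', hφ'⟩ := hL' (le_sup_right.trans h)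
      obtain ⟨N'', hN'', φ'', h''⟩ := hsup hN hN' φ φ'
      exact ⟨N'', hN'', φ'', (sup_le_sup hφ hφ').trans h''⟩
  -- Given `ψ : N → T / T'` with `N = Q / P`, lift it to `θ : Q → T`. Then `θ` sends the finitely
  -- generated `P` into `T'`, hence into the image of a single object `N₁`. The pushout of `N₁` and
  -- `Q` over `P` lies in `E`, and its image in `T` contains `θ(Q)`; thus `θ(Q) ≤ T'` and `ψ = 0`.
  have hfree : IsTorsionFree E (T ⧸ T') := by
    intro N hN ψ
    obtain ⟨_, Sig, hSig⟩ := hE.exists_presents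
    obtain ⟨i, π, hπ, hπσ⟩ := hSig.exists_surjective hN
    obtain ⟨θ, hθ⟩ := Module.projective_lifting_property T'.mkQ (ψ ∘ₗ π) T'.mkQ_surjective
    have hθT : LinearMap.range (θ ∘ₗ (Sig i).hom) ≤ T' := by
      rintro _ ⟨p, rfl⟩
      have : π ((Sig i).hom p) = 0 :=
        (hπσ ▸ LinearMap.mem_range_self (Sig i).hom p : (Sig i).hom p ∈ LinearMap.ker π)
      refine (Submodule.Quotient.mk_eq_zero T').mp ((LinearMap.congr_fun hθ _).trans ?_)
      rw [LinearMap.comp_apply, this, map_zero]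
    obtain ⟨N₁, hN₁, φ, hφ⟩ := hfg _ (Module.Finite.iff_fg.mp inferInstance) hθT
    obtain ⟨l, hl⟩ := exists_lift_of_range_le _ _ hφ
    have hN₂ := hE.pushout hN₁ hN (Sig i).hom (hSig.injective i) π hπ hπσ l
    have hz : LinearMap.range (l.prod (-(Sig i).hom)) ≤ LinearMap.ker (φ.coprod θ) := by
      rintro _ ⟨p, rfl⟩
      have := LinearMap.congr_fun hl p
      simp only [LinearMap.comp_apply] at this
      simp [this]
    ext n
    obtain ⟨q, rfl⟩ := hπ n
    refine (LinearMap.congr_fun hθ q).symm.trans ((Submodule.Quotient.mk_eq_zero T').mpr ?_)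
    exact ⟨_, hN₂, Submodule.liftQ _ _ hz, Submodule.Quotient.mk (0, q), by
      change φ 0 + θ q = θ q
      rw [map_zero, zero_add]⟩
  exact (Submodule.Quotient.mk_eq_zero T').mp (LinearMap.congr_fun (hT _ hfree T'.mkQ) x)

/-- Each element of `ker φ` lies in the image of some `ψ : N → T` with `N` in `E`, and so in the
image of `ker (φ ∘ ψ)`, which is torsion by `hD`. This reduces kernels on arbitrary torsion modules
to kernels on objects of `E`. -/
theorem IsTorsion.ker {T D : Type u} [AddCommGroup T] [Module Rᵐᵒᵖ T] [AddCommGroup D]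
    [Module Rᵐᵒᵖ D] (hT : IsTorsion E T) (φ : T →ₗ[Rᵐᵒᵖ] D)
    (hD : ∀ N : ModuleCat.{u} Rᵐᵒᵖ, E N → ∀ ψ : N →ₗ[Rᵐᵒᵖ] D, IsTorsion E (LinearMap.ker ψ)) :
    IsTorsion E (LinearMap.ker φ) := by
  intro F _ _ hF χ
  ext ⟨x, hx⟩
  by_cases h0 : ∃ N₀, E N₀
  · obtain ⟨N₀, hN₀⟩ := h0
    obtain ⟨N, hN, ψ, n, rfl⟩ := hT.exists_mem_range hE hN₀ x
    have h := hD N hN (φ ∘ₗ ψ) F hF (χ ∘ₗ ψ.restrict (q := LinearMap.ker φ) fun _ h => h)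
    exact LinearMap.congr_fun h ⟨n, hx⟩
  -- If `E` is empty, every module is torsion-free, so the identity of the torsion module `T` is
  -- zero.
  · have : x = 0 := LinearMap.congr_fun
      (hT T (fun N hN => absurd ⟨N, hN⟩ h0) LinearMap.id) x
    subst this
    exact map_zero χ

/-- If kernels of maps in `E` are torsion, then so are the kernels of maps from objects of `E` to
direct sums of objects of `E`. -/
theorem IsPreLocalising.isTorsion_ker_dfinsupp
    (hker : ∀ A B : ModuleCat.{u} Rᵐᵒᵖ, E A → E B → ∀ φ : A →ₗ[Rᵐᵒᵖ] B,
      IsTorsion E (LinearMap.ker φ))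
    {J : Type u} (D : J → ModuleCat.{u} Rᵐᵒᵖ) (hD : ∀ j, E (D j)) {N : ModuleCat.{u} Rᵐᵒᵖ}
    (hN : E N) (ψ : N →ₗ[Rᵐᵒᵖ] Π₀ j, D j) : IsTorsion E (LinearMap.ker ψ) := by
  classical
  -- Finitely many coordinates of `ψ` assemble into one map to an object of `E`, a finite product of
  -- the `D j` (with a factor `N`, receiving the zero map, to start the induction).
  have hs : ∀ s : Finset J, ∃ A : ModuleCat.{u} Rᵐᵒᵖ, E A ∧ ∃ φ : N →ₗ[Rᵐᵒᵖ] A,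
      ∀ n, φ n = 0 ↔ ∀ j ∈ s, ψ n j = 0 := by
    intro s
    induction s using Finset.induction_on with
    | empty => exact ⟨N, hN, 0, by simp⟩
    | insert j s _ ih =>
      obtain ⟨A, hA, φ, hφ⟩ := ih
      refine ⟨_, hE.prod (hD j) hA, (DFinsupp.lapply j ∘ₗ ψ).prod φ, fun n => ?_⟩
      change (ψ n j, φ n) = 0 ↔ _
      rw [Finset.forall_mem_insert, ← hφ, Prod.mk_eq_zero]
  have := hE.finitePresentation N hN
  obtain ⟨G, hG⟩ := Module.Finite.fg_top (R := Rᵐᵒᵖ) (M := N)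
  -- As `N` is finitely generated, the supports of the generators contain the support of every `ψ
  -- n`.
  let s : Finset J := G.biUnion fun n => (ψ n).support
  have hsupp : ∀ n, ∀ j ∉ s, ψ n j = 0 := by
    intro n j hj
    have : (⊤ : Submodule Rᵐᵒᵖ N) ≤ LinearMap.ker (DFinsupp.lapply j ∘ₗ ψ) := by
      rw [← hG, Submodule.span_le]
      intro g hg
      by_contra h
      exact hj (Finset.mem_biUnion.mpr ⟨g, hg, DFinsupp.mem_support_iff.mpr h⟩)
    exact this (Submodule.mem_top (x := n))
  obtain ⟨A, hA, φ, hφ⟩ := hs s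
  have : LinearMap.ker ψ = LinearMap.ker φ := by
    ext n
    rw [LinearMap.mem_ker, LinearMap.mem_ker, hφ, DFinsupp.ext_iff]
    exact ⟨fun h j _ => h j, fun h j => if hj : j ∈ s then h j hj else hsupp n j hj⟩
  rw [this]
  exact hker N A hN hA φ

end TorsionTheory

/-! ### Embedding torsion-free modules in torsion-free modules with the extension property. -/

section Embedding

variable {R : Type u} [Ring R] {E : ObjectProperty (ModuleCat.{u} Rᵐᵒᵖ)}

/-- A torsion-free module embeds in a torsion-free module to which all maps `P → M` from the
sources of the maps `P → Q` of a given small family extend. -/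
theorem IsPreLocalising.exists_embedding (hE : IsPreLocalising E)
    (hker : ∀ A B : ModuleCat.{u} Rᵐᵒᵖ, E A → E B → ∀ φ : A →ₗ[Rᵐᵒᵖ] B,
      IsTorsion E (LinearMap.ker φ))
    {ι : Type u} {Sig : ι → ProjMap R} (hSig : Presents Sig E)
    (M : ModuleCat.{u} Rᵐᵒᵖ) (hM : IsTorsionFree E M) :
    ∃ (M' : ModuleCat.{u} Rᵐᵒᵖ) (_ : IsTorsionFree E M') (a : M →ₗ[Rᵐᵒᵖ] M'),
      Function.Injective a ∧ ∀ i (f : (Sig i).P →ₗ[Rᵐᵒᵖ] M),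
        ∃ g : (Sig i).Q →ₗ[Rᵐᵒᵖ] M', g ∘ₗ (Sig i).hom = a ∘ₗ f := by
  classical
  -- One summand for each extension problem, so that a single pushout solves them all.
  let J : Type u := Σ i, (Sig i).P →ₗ[Rᵐᵒᵖ] M
  let l : (Π₀ j : J, (Sig j.1).P) →ₗ[Rᵐᵒᵖ] M := DFinsupp.lsum ℕ fun j => j.2
  let σ : (Π₀ j : J, (Sig j.1).P) →ₗ[Rᵐᵒᵖ] Π₀ j : J, (Sig j.1).Q :=
    DFinsupp.mapRange.linearMap fun j => (Sig j.1).hom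
  let π : (Π₀ j : J, (Sig j.1).Q) →ₗ[Rᵐᵒᵖ]
      Π₀ j : J, ModuleCat.of Rᵐᵒᵖ ((Sig j.1).Q ⧸ LinearMap.range (Sig j.1).hom) :=
    DFinsupp.mapRange.linearMap fun j => (LinearMap.range (Sig j.1).hom).mkQ
  have hσ : Function.Injective σ :=
    (DFinsupp.mapRange_injective _ fun j => map_zero (Sig j.1).hom).mpr
      fun j => hSig.injective j.1
  have hπσ : ∀ p, π (σ p) = 0 := fun p => by
    ext j : 1
    exact (Submodule.Quotient.mk_eq_zero _).mpr ⟨p j, rfl⟩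
  have hπ : ∀ q, π q = 0 → ∃ p, σ p = q := fun q hq => by
    have hq' : ∀ j, q j ∈ LinearMap.range (Sig j.1).hom := fun j =>
      (Submodule.Quotient.mk_eq_zero _).mp (DFunLike.congr_fun hq j)
    -- Preimages are chosen coordinatewise; the choice must send `0` to `0` to keep finite support,
    -- which injectivity ensures.
    have hinv : ∀ j : J, Function.invFun (Sig j.1).hom 0 = 0 := fun j => by
      rw [← map_zero (Sig j.1).hom]
      exact Function.leftInverse_invFun (hSig.injective j.1) 0
    refine ⟨DFinsupp.mapRange (fun j => Function.invFun (Sig j.1).hom) hinv q, ?_⟩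
    ext j : 1
    exact Function.invFun_eq (hq' j)
  let K := LinearMap.range (l.prod (-σ))
  let b : M →ₗ[Rᵐᵒᵖ] (M × Π₀ j : J, (Sig j.1).Q) ⧸ K := K.mkQ ∘ₗ LinearMap.inl _ _ _
  have hb : Function.Injective b := (injective_iff_map_eq_zero _).mpr fun m hm => by
    obtain ⟨p, hp⟩ := (Submodule.Quotient.mk_eq_zero _).mp hm
    have h1 : l p = m := congrArg Prod.fst hp
    have h2 : -σ p = 0 := congrArg Prod.snd hp
    rw [← h1, (map_eq_zero_iff σ hσ).mp (neg_eq_zero.mp h2), map_zero]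
  let δ : ((M × Π₀ j : J, (Sig j.1).Q) ⧸ K) →ₗ[Rᵐᵒᵖ]
      Π₀ j : J, ModuleCat.of Rᵐᵒᵖ ((Sig j.1).Q ⧸ LinearMap.range (Sig j.1).hom) :=
    K.liftQ (M₂ := Π₀ j : J, ModuleCat.of Rᵐᵒᵖ ((Sig j.1).Q ⧸ LinearMap.range (Sig j.1).hom))
      (π ∘ₗ LinearMap.snd _ _ _) (by
        rintro _ ⟨p, rfl⟩
        simp [hπσ])
  have hδ : ∀ y, δ y = 0 → ∃ m, b m = y := fun y hy => by
    obtain ⟨⟨m, q⟩, rfl⟩ := Submodule.mkQ_surjective _ y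
    obtain ⟨p, rfl⟩ := hπ q hy
    refine ⟨m + l p, (Submodule.Quotient.eq _).mpr ⟨p, ?_⟩⟩
    ext <;> simp
  let t := torsionSubmodule E ((M × Π₀ j : J, (Sig j.1).Q) ⧸ K)
  -- This kernel is the intersection of `t` with the copy `b(M)` of `M`, because `ker δ` is the
  -- range of `b`. Being torsion, it maps to zero under `b⁻¹` into the torsion-free `M`, so `M`
  -- still embeds after dividing by `t`.
  have ht := (isTorsion_torsionSubmodule E _).ker hE (δ ∘ₗ t.subtype) fun N hN ψ =>
    hE.isTorsion_ker_dfinsupp hker _ (fun j : J => hSig.cokernel_mem j.1) hN ψ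
  refine ⟨ModuleCat.of Rᵐᵒᵖ (_ ⧸ t), isTorsionFree_quotient_torsionSubmodule E _, t.mkQ ∘ₗ b,
    (injective_iff_map_eq_zero _).mpr fun m hm => ?_, fun i f => ?_⟩
  · have hm' : b m ∈ t := (Submodule.Quotient.mk_eq_zero _).mp hm
    have hbi : ∀ x : LinearMap.ker (δ ∘ₗ t.subtype), t.subtype x ∈ LinearMap.range b :=
      fun x => hδ _ x.2
    have h := ht M hM ((LinearEquiv.ofInjective b hb).symm.toLinearMap ∘ₗ
      (t.subtype ∘ₗ Submodule.subtype _).codRestrict _ hbi)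
    have hδb : δ (b m) = 0 := map_zero π
    refine Eq.trans (Eq.symm ?_) (LinearMap.congr_fun h ⟨⟨b m, hm'⟩, hδb⟩)
    exact (LinearEquiv.symm_apply_eq _).mpr rfl
  · let j : J := ⟨i, f⟩
    -- The extension of `f` is the inclusion of the summand of the sum of the `Q`s indexed by `(i,
    -- f)`; the pushout relation at that summand says that it restricts to `f`.
    refine ⟨t.mkQ ∘ₗ K.mkQ ∘ₗ LinearMap.inr _ _ _ ∘ₗ
      DFinsupp.lsingle (M := fun j : J => (Sig j.1).Q) j, LinearMap.ext fun p => ?_⟩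
    simp only [LinearMap.comp_apply, b]
    refine congrArg _ ((Submodule.Quotient.eq _).mpr
      ⟨-DFinsupp.lsingle (R := Rᵐᵒᵖ) (M := fun j : J => (Sig j.1).P) j p, ?_⟩)
    have h1 : l (DFinsupp.lsingle (R := Rᵐᵒᵖ) (M := fun j : J => (Sig j.1).P) j p) = f p :=
      DFinsupp.sumAddHom_single (fun j : J => j.2.toAddMonoidHom) j p
    have h2 : σ (DFinsupp.lsingle (R := Rᵐᵒᵖ) (M := fun j : J => (Sig j.1).P) j p) =
        DFinsupp.lsingle (R := Rᵐᵒᵖ) (M := fun j : J => (Sig j.1).Q) j ((Sig i).hom p) :=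
      DFinsupp.mapRange_single (hf := fun j : J => map_zero (Sig j.1).hom)
    refine Prod.ext ?_ ?_
    · change l (-_) = 0 - f p
      rw [map_neg, h1, zero_sub]
    · change -σ (-_) = DFinsupp.lsingle (R := Rᵐᵒᵖ) (M := fun j : J => (Sig j.1).Q) j
        ((Sig i).hom p) - 0
      rw [map_neg, h2, neg_neg, sub_zero]

/-- A finitely generated submodule of a direct limit is contained in the image of some term. -/
theorem exists_le_range_directLimit {A : Type*} [Ring A] {G : ℕ → Type*}
    [∀ n, AddCommGroup (G n)] [∀ n, Module A (G n)] (f : ∀ m n, m ≤ n → G m →ₗ[A] G n)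
    (L : Submodule A (Module.DirectLimit G f)) (hL : L.FG) :
    ∃ n, L ≤ LinearMap.range (Module.DirectLimit.of A ℕ G f n) := by
  induction L, hL using Submodule.fg_induction with
  | singleton x =>
    obtain ⟨n, y, hy⟩ := Module.DirectLimit.exists_of x
    exact ⟨n, (Submodule.span_singleton_le_iff_mem _ _).mpr ⟨y, hy⟩⟩
  | sup L L' _ _ hL hL' =>
    have mono : ∀ {m n}, m ≤ n → LinearMap.range (Module.DirectLimit.of A ℕ G f m) ≤
        LinearMap.range (Module.DirectLimit.of A ℕ G f n) := by
      rintro m n h _ ⟨y, rfl⟩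
      exact ⟨f m n h y, Module.DirectLimit.of_f⟩
    obtain ⟨m, hm⟩ := hL
    obtain ⟨n, hn⟩ := hL'
    exact ⟨max m n, sup_le (hm.trans (mono (le_max_left m n)))
      (hn.trans (mono (le_max_right m n)))⟩

/-- A torsion-free module embeds in a torsion-free module which is injective with respect to the
maps of a given small family presenting `E`. -/
theorem IsPreLocalising.exists_hull (hE : IsPreLocalising E)
    (hker : ∀ A B : ModuleCat.{u} Rᵐᵒᵖ, E A → E B → ∀ φ : A →ₗ[Rᵐᵒᵖ] B,
      IsTorsion E (LinearMap.ker φ))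
    {ι : Type u} {Sig : ι → ProjMap R} (hSig : Presents Sig E)
    (M : ModuleCat.{u} Rᵐᵒᵖ) (hM : IsTorsionFree E M) :
    ∃ (X : ModuleCat.{u} Rᵐᵒᵖ) (_ : IsTorsionFree E X) (a : M →ₗ[Rᵐᵒᵖ] X),
      Function.Injective a ∧ ∀ i (f : (Sig i).P →ₗ[Rᵐᵒᵖ] X),
        ∃ g : (Sig i).Q →ₗ[Rᵐᵒᵖ] X, g ∘ₗ (Sig i).hom = f := by
  choose next hnext emb hemb hext using hE.exists_embedding hker hSig
  -- Torsion-freeness is carried along in the recursion because the next stage is defined only for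
  -- torsion-free modules.
  let G : ℕ → {M : ModuleCat.{u} Rᵐᵒᵖ // IsTorsionFree E M} := fun n =>
    Nat.rec ⟨M, hM⟩ (fun _ M => ⟨next M.1 M.2, hnext M.1 M.2⟩) n
  let s : ∀ n, (G n).1 →ₗ[Rᵐᵒᵖ] (G (n + 1)).1 := fun n => emb (G n).1 (G n).2
  have hs : ∀ n, Function.Injective (s n) := fun n => hemb _ _
  let f : ∀ m n, m ≤ n → (G m).1 →ₗ[Rᵐᵒᵖ] (G n).1 := fun m n h =>
    Nat.leRec (motive := fun n _ => (G m).1 →ₗ[Rᵐᵒᵖ] (G n).1) LinearMap.id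
      (fun k _ g => s k ∘ₗ g) h
  have f_self : ∀ m, f m m le_rfl = LinearMap.id := fun m => Nat.leRec_self _ _
  have f_succ : ∀ m n (h : m ≤ n), f m (n + 1) (h.trans n.le_succ) = s n ∘ₗ f m n h :=
    fun m n h => Nat.leRec_succ _ _ h
  have f_inj : ∀ m n (h : m ≤ n), Function.Injective (f m n h) := by
    intro m n h
    induction n, h using Nat.le_induction with
    | base => rw [f_self]; exact Function.injective_id
    | succ n h ih => rw [f_succ m n h]; exact (hs n).comp ih
  have : DirectedSystem (fun n => (G n).1) fun m n h => f m n h :=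
    { map_self := fun m x => by rw [f_self]; rfl
      map_map := fun k j i hij hjk x => by
        induction k, hjk using Nat.le_induction with
        | base => rw [f_self]; rfl
        | succ n h ih =>
          rw [f_succ j n h, f_succ i n (hij.trans h), LinearMap.comp_apply, ih]
          rfl }
  let X := Module.DirectLimit (fun n => (G n).1) f
  let c : ∀ n, (G n).1 →ₗ[Rᵐᵒᵖ] X := Module.DirectLimit.of Rᵐᵒᵖ ℕ (fun n => (G n).1) f
  have hcs : ∀ n, c (n + 1) ∘ₗ s n = c n := fun n => by
    have h1 : f n (n + 1) n.le_succ = s n := by rw [f_succ n n le_rfl, f_self]; rfl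
    ext x
    rw [← h1]
    exact Module.DirectLimit.of_f
  have hc : ∀ n, Function.Injective (c n) := fun n =>
    (injective_iff_map_eq_zero _).mpr fun x hx => by
      obtain ⟨m, h, h0⟩ := Module.DirectLimit.of.zero_exact hx
      exact (map_eq_zero_iff _ (f_inj n m h)).mp h0
  refine ⟨ModuleCat.of Rᵐᵒᵖ X, fun N hN φ => ?_, c 0, hc 0, fun i φ => ?_⟩
  -- A map from the finitely generated `N` lands in one stage, which is torsion-free.
  · have := hE.finitePresentation N hN
    obtain ⟨n, hn⟩ := exists_le_range_directLimit f (LinearMap.range φ)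
      (Module.Finite.iff_fg.mp inferInstance)
    have h := (G n).2.of_injective (LinearEquiv.ofInjective (c n) (hc n)).symm.toLinearMap
      (LinearEquiv.injective _) N hN (φ.codRestrict _ fun x => hn ⟨x, rfl⟩)
    ext x
    exact congrArg Subtype.val (LinearMap.congr_fun h x)
  -- A map from the finitely generated projective `P` lifts to stage `n`, and extends to `Q` at
  -- stage `n + 1`.
  · obtain ⟨n, hn⟩ := exists_le_range_directLimit f (LinearMap.range φ)
      (Module.Finite.iff_fg.mp inferInstance)
    obtain ⟨ψ, hψ⟩ := exists_lift_of_range_le φ (c n) hn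
    obtain ⟨g, hg⟩ := hext (G n).1 (G n).2 i ψ
    refine ⟨c (n + 1) ∘ₗ g, ?_⟩
    rw [LinearMap.comp_assoc, hg, ← LinearMap.comp_assoc]
    exact (congrArg (· ∘ₗ ψ) (hcs n)).trans hψ

/-- Whether all maps to `X` extend along an injective map between projective modules depends only
on the cokernel of that map. -/
theorem exists_extension_of_equiv_coker {A : Type*} [Ring A] {P Q P' Q' N X : Type*}
    [AddCommGroup P] [Module A P] [AddCommGroup Q] [Module A Q] [AddCommGroup P'] [Module A P']
    [AddCommGroup Q'] [Module A Q'] [AddCommGroup N] [Module A N] [AddCommGroup X] [Module A X]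
    [Module.Projective A P] [Module.Projective A Q] [Module.Projective A P']
    [Module.Projective A Q'] (σ : P →ₗ[A] Q) (hσ : Function.Injective σ) (π : Q →ₗ[A] N)
    (hπ : Function.Surjective π) (hπσ : LinearMap.ker π = LinearMap.range σ)
    (σ' : P' →ₗ[A] Q') (π' : Q' →ₗ[A] N) (hπ' : Function.Surjective π')
    (hπσ' : LinearMap.ker π' = LinearMap.range σ')
    (h : ∀ f : P' →ₗ[A] X, ∃ g : Q' →ₗ[A] X, g ∘ₗ σ' = f) (f : P →ₗ[A] X) :
    ∃ g : Q →ₗ[A] X, g ∘ₗ σ = f := by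
  have z : ∀ p, π (σ p) = 0 := fun p =>
    (hπσ ▸ LinearMap.mem_range_self σ p : σ p ∈ LinearMap.ker π)
  have z' : ∀ p, π' (σ' p) = 0 := fun p =>
    (hπσ' ▸ LinearMap.mem_range_self σ' p : σ' p ∈ LinearMap.ker π')
  -- The two resolutions of `N` are compared by chain maps `(a, b)` and `(a', b')` lifting the
  -- identity, with a homotopy `k : Q → P` satisfying `a a' - 1 = σ k`.
  obtain ⟨a, ha⟩ := Module.projective_lifting_property π π' hπ
  obtain ⟨a', ha'⟩ := Module.projective_lifting_property π' π hπ'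
  replace ha := LinearMap.congr_fun ha
  replace ha' := LinearMap.congr_fun ha'
  simp only [LinearMap.comp_apply] at ha ha'
  obtain ⟨b, hb⟩ := exists_lift_of_range_le (a ∘ₗ σ') σ (by
    rw [← hπσ]
    rintro _ ⟨p, rfl⟩
    simp [ha, z'])
  obtain ⟨b', hb'⟩ := exists_lift_of_range_le (a' ∘ₗ σ) σ' (by
    rw [← hπσ']
    rintro _ ⟨p, rfl⟩
    simp [ha', z])
  obtain ⟨k, hk⟩ := exists_lift_of_range_le (a ∘ₗ a' - LinearMap.id) σ (by
    rw [← hπσ]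
    rintro _ ⟨p, rfl⟩
    simp [ha', ha])
  replace hb := LinearMap.congr_fun hb
  replace hb' := LinearMap.congr_fun hb'
  replace hk := LinearMap.congr_fun hk
  simp only [LinearMap.comp_apply, LinearMap.sub_apply, LinearMap.id_apply] at hb hb' hk
  obtain ⟨g, hg⟩ := h (f ∘ₗ b)
  replace hg := LinearMap.congr_fun hg
  simp only [LinearMap.comp_apply] at hg
  -- `g a'` restricts along `σ` to `f b b'`, and `b b' = 1 + k σ`; subtracting `f k` removes the
  -- error.
  refine ⟨g ∘ₗ a' - f ∘ₗ k, LinearMap.ext fun p => ?_⟩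
  have : b (b' p) - k (σ p) = p := hσ (by rw [map_sub, hb, hb', hk, sub_sub_cancel])
  simp only [LinearMap.comp_apply, LinearMap.sub_apply]
  rw [← hb', hg, ← map_sub, this]

end Embedding

/-! ### From unique extension of maps into `X` to an `R_Σ`-module structure on `X`. -/

section Inverting

variable {R : Type u} [Ring R]

/-- The homomorphism to the opposite of the additive endomorphism ring of `X` given by the right
`R`-module structure on `X`. -/
def toEndOp (X : Type u) [AddCommGroup X] [Module Rᵐᵒᵖ X] : R →+* (AddMonoid.End X)ᵐᵒᵖ where
  toFun r := op (Module.toAddMonoidEnd Rᵐᵒᵖ X (op r))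
  map_one' := by rw [op_one, map_one, op_one]
  map_mul' r s := by rw [op_mul, map_mul, op_mul]
  map_zero' := by rw [op_zero, map_zero, op_zero]
  map_add' r s := by rw [MulOpposite.op_add, map_add, MulOpposite.op_add]

theorem unop_toEndOp_apply {X : Type u} [AddCommGroup X] [Module Rᵐᵒᵖ X] (r : R) (x : X) :
    (toEndOp X r).unop x = op r • x := rfl

theorem Induced.sum_tmul_dualBasis {T : Type v} [Ring T] (g : R →+* T) {Q : Type u}
    [AddCommGroup Q] [Module Rᵐᵒᵖ Q] {n : ℕ} (q : Fin n → Q) (k : Fin n → (Q →ₗ[Rᵐᵒᵖ] R))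
    (hqk : ∀ x, ∑ a, op (k a x) • q a = x) (x : Q) (t : T) :
    tmul g x t = ∑ a, tmul g (q a) (g (k a x) * t) := by
  let φ : Q →+ Induced g Q := AddMonoidHom.mk' (fun y => tmul g y t) fun y y' => add_tmul g y y' t
  have h := congrArg φ (hqk x)
  rw [map_sum] at h
  exact h.symm.trans (Finset.sum_congr rfl fun a _ => tmul_smul g (q a) _ t)

/-- If every map `P → X` extends uniquely along `α : P → Q`, then the ring homomorphism from `R`
to the endomorphisms of the abelian group `X` inverts `α`. -/
theorem inverts_toEndOp (α : ProjMap R) (X : Type u) [AddCommGroup X] [Module Rᵐᵒᵖ X]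
    (hex : ∀ f : α.P →ₗ[Rᵐᵒᵖ] X, ∃ g : α.Q →ₗ[Rᵐᵒᵖ] X, g ∘ₗ α.hom = f)
    (huniq : ∀ g g' : α.Q →ₗ[Rᵐᵒᵖ] X, g ∘ₗ α.hom = g' ∘ₗ α.hom → g = g') :
    Inverts (toEndOp X) α := by
  obtain ⟨n, p, l, hpl⟩ := exists_dualBasis (R := R) α.P
  obtain ⟨m, q, k, hqk⟩ := exists_dualBasis (R := R) α.Q
  have hl : ∀ (P : Type u) [AddCommGroup P] [Module Rᵐᵒᵖ P] (e : P →ₗ[Rᵐᵒᵖ] R) (x : X),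
      ∃ f : P →ₗ[Rᵐᵒᵖ] X, ∀ y, f y = op (e y) • x := fun P _ _ e x =>
    ⟨{ toFun := fun y => op (e y) • x
       map_add' := fun y y' => by rw [map_add, MulOpposite.op_add, add_smul]
       map_smul' := fun r y => by
        rw [map_smul, RingHom.id_apply, ← mul_smul]
        rfl }, fun _ => rfl⟩
  -- `L j x` extends the map `y ↦ x · l j (y)` from `P` to `Q`; by uniqueness it is additive in `x`.
  have hL : ∀ (j : Fin n) (x : X), ∃ g : α.Q →ₗ[Rᵐᵒᵖ] X, ∀ y, g (α.hom y) = op (l j y) • x := by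
    intro j x
    obtain ⟨f, hf⟩ := hl α.P (l j) x
    obtain ⟨g, rfl⟩ := hex f
    exact ⟨g, hf⟩
  choose L hL using hL
  have hLadd : ∀ j x x', L j (x + x') = L j x + L j x' := fun j x x' =>
    huniq _ _ (LinearMap.ext fun y => by
      simp only [LinearMap.comp_apply, LinearMap.add_apply, hL, smul_add])
  -- The endomorphism `x ↦ L j x y` plays the role of `l j (α⁻¹ y)`, so the inverse of `α ⊗ S` must
  -- be `y ↦ ∑ j, p j ⊗ Λ j y`.
  let Λ : Fin n → α.Q → (AddMonoid.End X)ᵐᵒᵖ := fun j y =>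
    op (AddMonoidHom.mk' (fun x => L j x y) fun x x' => by rw [hLadd]; rfl)
  have hΛadd : ∀ j y y', Λ j (y + y') = Λ j y + Λ j y' := fun j y y' =>
    congrArg op (AddMonoidHom.ext fun x => map_add (L j x) y y')
  have hΛsmul : ∀ j y r, Λ j (op r • y) = Λ j y * toEndOp X r := fun j y r =>
    congrArg op (AddMonoidHom.ext fun x => map_smul (L j x) (op r) y)
  have hΛhom : ∀ j y, Λ j (α.hom y) = toEndOp X (l j y) := fun j y =>
    congrArg op (AddMonoidHom.ext fun x => hL j x y)
  let β : Induced (toEndOp (R := R) X) α.Q →ₗ[((AddMonoid.End X)ᵐᵒᵖ)ᵐᵒᵖ]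
      Induced (toEndOp (R := R) X) α.P :=
    Induced.lift (toEndOp X) (AddMonoidHom.mk' (fun y => ∑ j, Induced.tmul (toEndOp X) (p j) (Λ j y)) (by
      intro y y'
      simp only [hΛadd, Induced.tmul_add, Finset.sum_add_distrib])) (by
      intro y (r : R)
      simp only [AddMonoidHom.mk'_apply, Finset.smul_sum, Induced.smul_tmul, hΛsmul])
  have hβ : ∀ y, β (Induced.tmul _ y 1) = ∑ j, Induced.tmul (toEndOp X) (p j) (Λ j y) := by
    intro y
    rw [Induced.lift_tmul, op_one, one_smul]
    rfl
  have h1 : β ∘ₗ Induced.map (toEndOp X) α.hom = LinearMap.id := by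
    refine Induced.hom_ext _ fun y => ?_
    rw [LinearMap.comp_apply, Induced.map_tmul, hβ, LinearMap.id_apply,
      Induced.sum_tmul_dualBasis _ p l hpl y 1]
    simp only [hΛhom, mul_one]
  have h2 : Induced.map (toEndOp X) α.hom ∘ₗ β = LinearMap.id := by
    refine Induced.hom_ext _ fun y => ?_
    rw [LinearMap.comp_apply, hβ, map_sum, LinearMap.id_apply,
      Induced.sum_tmul_dualBasis _ q k hqk y 1]
    simp only [Induced.map_tmul]
    rw [Finset.sum_congr rfl fun j _ =>
      Induced.sum_tmul_dualBasis _ q k hqk (α.hom (p j)) (Λ j y), Finset.sum_comm]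
    refine Finset.sum_congr rfl fun a _ => ?_
    have hsum : ∀ s : Fin n → (AddMonoid.End X)ᵐᵒᵖ,
        ∑ j, Induced.tmul (toEndOp (R := R) X) (q a) (s j) =
          Induced.tmul (toEndOp (R := R) X) (q a) (∑ j, s j) := fun s =>
      (map_sum (AddMonoidHom.mk' (Induced.tmul (toEndOp (R := R) X) (q a))
        (Induced.tmul_add _ (q a))) s _).symm
    rw [hsum, mul_one]
    congr 1
    refine unop_injective (AddMonoidHom.ext fun x => ?_)
    obtain ⟨f, hf⟩ := hl α.Q (k a) x
    -- Comparing coefficients of `q a` leaves an identity between maps `Q → X`; both sides agree on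
    -- `P` by the dual basis expansion there, hence agree by uniqueness of extensions.
    have hsumL : ∑ j, L j (op (k a (α.hom (p j))) • x) = f := huniq _ _ <| by
      ext y
      rw [LinearMap.comp_apply, LinearMap.comp_apply, LinearMap.sum_apply]
      simp only [hL]
      conv_rhs => rw [← hpl y, map_sum, map_sum]
      refine Finset.sum_congr rfl fun j _ => ?_
      rw [map_smul, map_smul, hf]
    have h := LinearMap.congr_fun hsumL y
    rw [hf, LinearMap.sum_apply] at h
    let ev : (AddMonoid.End X)ᵐᵒᵖ →+ X := AddMonoidHom.mk' (fun T => T.unop x) fun _ _ => rfl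
    exact (map_sum ev _ _).trans h
  exact ⟨Function.LeftInverse.injective (LinearMap.congr_fun h1),
    Function.RightInverse.surjective (LinearMap.congr_fun h2)⟩

/-- A homomorphism to a right `R`-module whose `R`-action extends to `R_Σ` kills the kernel of the
natural map `M → M ⊗_R R_Σ`. -/
theorem ker_unit_le_ker {ι : Type w} (Sig : ι → ProjMap R) {M X : Type u} [AddCommGroup M]
    [Module Rᵐᵒᵖ M] [AddCommGroup X] [Module Rᵐᵒᵖ X]
    (hX : ∀ i, Inverts (toEndOp X) (Sig i)) (φ : M →ₗ[Rᵐᵒᵖ] X) :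
    LinearMap.ker (Induced.unit (toLoc Sig) M) ≤ LinearMap.ker φ := by
  obtain ⟨h, hh, -⟩ := existsUnique_lift Sig (toEndOp X) hX
  -- The universal property extends the right `R`-action on `X` to `R_Σ`, and then `φ` factors
  -- through the unit by the universal property of the induced module.
  let act : (Loc Sig)ᵐᵒᵖ →+* AddMonoid.End X :=
    (RingEquiv.opOp (AddMonoid.End X)).symm.toRingHom.comp (RingHom.op h)
  let _ : Module (Loc Sig)ᵐᵒᵖ X := Module.compHom X act
  have hact : ∀ r x, op (toLoc Sig r) • x = (op r • x : X) := fun r x => by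
    change (h (toLoc Sig r)).unop x = _
    rw [← RingHom.comp_apply, hh, unop_toEndOp_apply]
  let ψ := Induced.lift (toLoc Sig) (φ : M →+ X) fun m r => by
    rw [hact]
    exact map_smul φ (op r) m
  intro m hm
  have h1 : ψ (Induced.tmul (toLoc Sig) m 1) = φ m := by
    rw [Induced.lift_tmul, op_one, one_smul]
    rfl
  have h2 : Induced.tmul (toLoc Sig) m 1 = 0 := hm
  rw [LinearMap.mem_ker, ← h1, h2, map_zero]

end Inverting

/-! ### The two inclusions between the kernel and the torsion submodule. -/

section Kernel

variable {R : Type u} [Ring R] {E : ObjectProperty (ModuleCat.{u} Rᵐᵒᵖ)}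

/-- Torsion-freeness supplies the uniqueness of extensions: the difference of two extensions factors
through the cokernel of `P → Q`, an object of `E`. -/
theorem IsTorsionFree.inverts_toEndOp {ι : Type w} {Sig : ι → ProjMap R} (hSig : Presents Sig E)
    {X : Type u} [AddCommGroup X] [Module Rᵐᵒᵖ X] (hX : IsTorsionFree E X) (i : ι)
    (hex : ∀ f : (Sig i).P →ₗ[Rᵐᵒᵖ] X, ∃ g : (Sig i).Q →ₗ[Rᵐᵒᵖ] X, g ∘ₗ (Sig i).hom = f) :
    Inverts (toEndOp X) (Sig i) := by
  refine UnivLoc.inverts_toEndOp _ X hex fun g g' hgg' => ?_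
  have hz : LinearMap.range (Sig i).hom ≤ LinearMap.ker (g - g') := by
    rintro _ ⟨p, rfl⟩
    exact sub_eq_zero.mpr (LinearMap.congr_fun hgg' p)
  have h := hX _ (hSig.cokernel_mem i) (Submodule.liftQ _ _ hz)
  ext q
  exact sub_eq_zero.mp (LinearMap.congr_fun h (Submodule.Quotient.mk q))

theorem ker_unit_le_torsionSubmodule (hE : IsPreLocalising E)
    (hker : ∀ A B : ModuleCat.{u} Rᵐᵒᵖ, E A → E B → ∀ φ : A →ₗ[Rᵐᵒᵖ] B,
      IsTorsion E (LinearMap.ker φ))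
    {ι : Type w} {Sig : ι → ProjMap R} (hSig : Presents Sig E)
    (M : Type u) [AddCommGroup M] [Module Rᵐᵒᵖ M] :
    LinearMap.ker (Induced.unit (toLoc Sig) M) ≤ torsionSubmodule E M := by
  -- The hull is built from direct sums indexed by the family, so a family indexed in universe `u`
  -- is needed; `exists_extension_of_equiv_coker` then transfers the extension property to `Sig`.
  obtain ⟨ι', Sig', hSig'⟩ := hE.exists_presents
  obtain ⟨X, hX, a, ha, hext⟩ := hE.exists_hull hker hSig'
    (ModuleCat.of Rᵐᵒᵖ (M ⧸ torsionSubmodule E M)) (isTorsionFree_quotient_torsionSubmodule E M)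
  have hinv : ∀ i, Inverts (toEndOp X) (Sig i) := fun i => by
    refine hX.inverts_toEndOp hSig i fun f => ?_
    obtain ⟨i', π, hπ, hπσ⟩ := hSig'.exists_surjective (hSig.cokernel_mem i)
    exact exists_extension_of_equiv_coker _ (hSig.injective i) _ (Submodule.mkQ_surjective _)
      (Submodule.ker_mkQ _) _ π hπ hπσ (hext i') f
  refine (ker_unit_le_ker Sig hinv (a ∘ₗ (torsionSubmodule E M).mkQ)).trans ?_
  intro m hm
  exact (Submodule.Quotient.mk_eq_zero _).mp ((map_eq_zero_iff a ha).mp hm)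

/-- The quotient embeds in `M ⊗ R_Σ`, and a map from `Q / P` to an `R_Σ`-module vanishes because `P
⊗ R_Σ → Q ⊗ R_Σ` is surjective. -/
theorem isTorsionFree_quotient_ker_unit {ι : Type w} {Sig : ι → ProjMap R}
    (hSig : Presents Sig E) (M : Type u) [AddCommGroup M] [Module Rᵐᵒᵖ M] :
    IsTorsionFree E (M ⧸ LinearMap.ker (Induced.unit (toLoc Sig) M)) := by
  intro N hN ψ
  obtain ⟨i, π, hπ, hπσ⟩ := hSig.exists_surjective hN
  let j : (M ⧸ LinearMap.ker (Induced.unit (toLoc Sig) M)) →ₛₗ[(toLoc Sig).op]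
    Induced (toLoc Sig) M := Submodule.liftQ _ (Induced.unit (toLoc Sig) M) le_rfl
  have hj : Function.Injective j := LinearMap.ker_eq_bot.mp (Submodule.ker_liftQ_eq_bot _ _ _ le_rfl)
  -- The `R_Σ`-linear extension of `j ∘ ψ ∘ π`; it is zero on the image of `P ⊗ R_Σ` since `π` kills
  -- `P`.
  let u : Induced (toLoc Sig) (Sig i).Q →ₗ[(Loc Sig)ᵐᵒᵖ] Induced (toLoc Sig) M :=
    Induced.lift _ (AddMonoidHom.mk' (fun q => j (ψ (π q))) fun q q' => by simp only [map_add])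
      fun q r => by
        change j (ψ (π (op r • q))) = _
        rw [map_smul, map_smul, map_smulₛₗ]
        rfl
  have hu : u = 0 := by
    refine LinearMap.ext fun z => ?_
    obtain ⟨y, rfl⟩ := (inverts_toLoc Sig i).2 z
    suffices h : u ∘ₗ Induced.map (toLoc Sig) (Sig i).hom = 0 from LinearMap.congr_fun h y
    refine Induced.hom_ext _ fun p => ?_
    have hp : π ((Sig i).hom p) = 0 :=
      (hπσ ▸ LinearMap.mem_range_self (Sig i).hom p : (Sig i).hom p ∈ LinearMap.ker π)
    rw [LinearMap.comp_apply, Induced.map_tmul, Induced.lift_tmul, AddMonoidHom.mk'_apply, hp,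
      map_zero, map_zero, smul_zero, LinearMap.zero_apply]
  ext n
  obtain ⟨q, rfl⟩ := hπ n
  refine hj ?_
  have h : u (Induced.tmul _ q 1) = j (ψ (π q)) := by
    rw [Induced.lift_tmul, op_one, one_smul]
    rfl
  rw [← h, hu, LinearMap.zero_apply, LinearMap.zero_apply, map_zero]

theorem torsionSubmodule_le_ker_unit {ι : Type w} {Sig : ι → ProjMap R}
    (hSig : Presents Sig E) (M : Type u) [AddCommGroup M] [Module Rᵐᵒᵖ M] :
    torsionSubmodule E M ≤ LinearMap.ker (Induced.unit (toLoc Sig) M) := fun m hm =>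
  (Submodule.Quotient.mk_eq_zero _).mp (LinearMap.congr_fun
    (isTorsion_torsionSubmodule E M _ (isTorsionFree_quotient_ker_unit hSig M)
      (Submodule.mkQ _ ∘ₗ (torsionSubmodule E M).subtype)) ⟨m, hm⟩)

end Kernel

end UnivLoc

theorem mainTheorem5 {R : Type u} [Ring R] (E : ObjectProperty (ModuleCat.{u} Rᵐᵒᵖ))
    (hE : UnivLoc.IsPreLocalising E)
    (hker : ∀ A B : ModuleCat.{u} Rᵐᵒᵖ, E A → E B → ∀ φ : A →ₗ[Rᵐᵒᵖ] B,
      UnivLoc.IsTorsion E (LinearMap.ker φ))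
    {ι : Type w} (Sig : ι → UnivLoc.ProjMap R) (hSig : UnivLoc.Presents Sig E)
    (M : Type u) [AddCommGroup M] [Module Rᵐᵒᵖ M] [Module.FinitePresentation Rᵐᵒᵖ M] :
    LinearMap.ker (UnivLoc.Induced.unit (UnivLoc.toLoc Sig) M) = UnivLoc.torsionSubmodule E M ∧
      (UnivLoc.IsTorsionFree E M →
        Function.Injective (UnivLoc.Induced.unit (UnivLoc.toLoc Sig) M)) := by
  have h := (UnivLoc.ker_unit_le_torsionSubmodule hE hker hSig M).antisymm
    (UnivLoc.torsionSubmodule_le_ker_unit hSig M)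
  refine ⟨h, fun hM => LinearMap.ker_eq_bot.mp ?_⟩
  rw [h, hM.torsionSubmodule_eq_bot]
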